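/- Let $n\ge 1$ and $k\ge 0$ be integers, and write $[n]=\{1,\dots,n\}$. A tuple $\alpha=(a_1,\dots,a_n)\in[n]^n$ is a \emph{Fubini ranking} if it records a valid ranking of $n$ competitors with ties allowed, that is, $a_i=1+|\{j: a_j<a_i\}|$ for all $i$ (if $m$ competitors tie at rank $r$, the ranks $r+1,\dots,r+m-1$ are not used). Its \emph{ranks} are its distinct values. Regard $\alpha$ also as the parking preferences of cars $1,\dots,n$, which arrive in this order on a one-way street with spots $1,\dots,n$: car $i$ parks in the first unoccupied spot among $a_i,a_i+1,\dots,n$, if there is one. The tuple $\alpha$ is a \emph{unit interval parking function} if every car is able to park and each car $i$ parks in spot $a_i$ or $a_i+1$. Its \emph{outcome} is then the permutation $\pi=\pi_1\cdots\pi_n\in\mathfrak S_n$, in one-line notation, for which $\pi_j$ is the car parked in spot $j$. A \emph{unit Fubini ranking} of length $n$ is a Fubini ranking that is also a unit interval parking function. Let $s_i=(i,i+1)$ for $1\le i\le n-1$. The right weak order $W(\mathfrak S_n)$ is the partial order on $\mathfrak S_n$ whose cover relations are $\tau\lessdot\sigma$ if and only if $\sigma=\tau s_i$ for some $i$ with $\sigma_i>\sigma_{i+1}$.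 A \emph{Boolean interval of rank $k$} is an interval $[\sigma,\tau]$, $\sigma\le\tau$, of $W(\mathfrak S_n)$ that is isomorphic, as a poset, to the poset of all subsets of a $k$-element set ordered by inclusion. \textbf{Theorem.} The map $$\alpha\longmapsto\Bigl[\pi,\ \pi\prod_{i\in I}s_i\Bigr],$$ where $\pi$ is the outcome of $\alpha$ and $I$ is the set of values that occur more than once in $\alpha$ (the transpositions $s_i$, $i\in I$, commute pairwise), is a bijection from the set of unit Fubini rankings of length $n$ with exactly $n-k$ distinct ranks onto the set of Boolean intervals of rank $k$ in $W(\mathfrak S_n)$. -/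

import Mathlib

/-!
The set `[n] = {1, …, n}` is modelled by `Fin n = {0, …, n - 1}`: the number `i + 1` of `[n]`
corresponds to `i : Fin n`.  This applies to competitors, ranks, cars, parking spots, and the
positions and values of a permutation.  Similarly `[n - 1]` is modelled by `Fin (n - 1)`.
-/

namespace UnitFubini

variable {n : ℕ}

/-! ### The right weak order on the symmetric group -/

/-- The element `i` of `[n - 1]`, viewed in `[n]`. -/
def lo (i : Fin (n - 1)) : Fin n := ⟨i, by omega⟩

/-- The element `i + 1` of `[n]`, for `i` in `[n - 1]`. -/
def hi (i : Fin (n - 1)) : Fin n := ⟨i + 1, by omega⟩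

/-- The simple transposition `s_i = (i, i + 1)`. -/
def simple (i : Fin (n - 1)) : Equiv.Perm (Fin n) := Equiv.swap (lo i) (hi i)

/-- `i` is a descent of `σ` (in one-line notation `σ = σ 0, σ 1, …`). -/
def IsDescent (σ : Equiv.Perm (Fin n)) (i : Fin (n - 1)) : Prop := σ (hi i) < σ (lo i)

/-- The cover relation of the right weak order: `τ s_i = σ` for some descent `i` of `σ`. -/
def WeakCover (τ σ : Equiv.Perm (Fin n)) : Prop := ∃ i, IsDescent σ i ∧ τ * simple i = σ

theorem WeakCover.toLex_lt {τ σ : Equiv.Perm (Fin n)} (h : WeakCover τ σ) :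
    toLex (⇑τ) < toLex (⇑σ) := by
  obtain ⟨i, hd, rfl⟩ := h
  refine ⟨lo i, fun j hj => ?_, ?_⟩
  · have h1 : j ≠ lo i := ne_of_lt hj
    have h2 : j ≠ hi i := by
      have : lo i < hi i := by simp [lo, hi]
      exact ne_of_lt (hj.trans this)
    simp [simple, Equiv.swap_apply_of_ne_of_ne h1 h2]
  · simpa [IsDescent, simple] using hd

theorem toLex_le_of_reflTransGen {τ σ : Equiv.Perm (Fin n)}
    (h : Relation.ReflTransGen WeakCover τ σ) : toLex (⇑τ) ≤ toLex (⇑σ) := by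
  induction h with
  | refl => exact le_rfl
  | tail _ hc ih => exact ih.trans hc.toLex_lt.le

/-- The symmetric group on `[n]`, to be ordered by the right weak order. -/
def WeakOrder (n : ℕ) : Type := Equiv.Perm (Fin n)

/-- A permutation as an element of the weak order. -/
def toWeak (σ : Equiv.Perm (Fin n)) : WeakOrder n := σ

/-- The right weak order: the reflexive transitive closure of its cover relation. -/
instance : PartialOrder (WeakOrder n) where
  le τ σ := Relation.ReflTransGen (WeakCover (n := n)) τ σ
  le_refl _ := Relation.ReflTransGen.refl
  le_trans _ _ _ := Relation.ReflTransGen.trans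
  le_antisymm _ _ h₁ h₂ := DFunLike.coe_injective (F := Equiv.Perm (Fin n)) <|
    toLex.injective <| le_antisymm (toLex_le_of_reflTransGen h₁) (toLex_le_of_reflTransGen h₂)

/-- `B` is an interval `[σ, τ]` with `σ ≤ τ` of the right weak order which, as a poset, is
isomorphic to the poset of all subsets of a `k`-element set, ordered by inclusion. -/
def IsBooleanInterval (k : ℕ) (B : Set (WeakOrder n)) : Prop :=
  (∃ σ τ : WeakOrder n, σ ≤ τ ∧ B = Set.Icc σ τ) ∧ Nonempty (B ≃o Finset (Fin k))

/-! ### Parking -/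

/-- Given preferences `α`, the cars `0, 1, …` arrive one at a time, and car `i` parks in spot
`s i`: the first spot, from its preferred spot `α i` on, that no earlier car occupies. -/
def Parks (α s : Fin n → Fin n) : Prop :=
  ∀ i, IsLeast {t | α i ≤ t ∧ ∀ j < i, s j ≠ t} (s i)

/-- All cars are able to park. -/
def IsParkingFunction (α : Fin n → Fin n) : Prop := ∃ s, Parks α s

/-- Every car parks in its preferred spot or in the spot right after it. -/
def IsUnitIntervalParkingFunction (α : Fin n → Fin n) : Prop :=
  ∃ s, Parks α s ∧ ∀ i, (s i : ℕ) = α i ∨ (s i : ℕ) = α i + 1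

theorem IsUnitIntervalParkingFunction.isParkingFunction {α : Fin n → Fin n}
    (h : IsUnitIntervalParkingFunction α) : IsParkingFunction α :=
  h.imp fun _ hs => hs.1

theorem Parks.injective {α s : Fin n → Fin n} (h : Parks α s) : Function.Injective s := by
  intro i j hij
  rcases lt_trichotomy i j with hlt | heq | hlt
  · exact absurd hij ((h j).1.2 i hlt)
  · exact heq
  · exact absurd hij.symm ((h i).1.2 j hlt)

/-- The spots in which the cars park are determined by the preferences. -/
theorem Parks.unique {α s t : Fin n → Fin n} (hs : Parks α s) (ht : Parks α t) : s = t := by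
  funext i
  induction i using WellFoundedLT.induction with
  | ind i ih =>
    have e : {u | α i ≤ u ∧ ∀ j < i, s j ≠ u} = {u | α i ≤ u ∧ ∀ j < i, t j ≠ u} := by
      ext u
      exact and_congr_right fun _ => forall₂_congr fun j hj => by rw [ih j hj]
    exact (hs i).unique (e ▸ ht i)

/-- The outcome of a parking function, in one-line notation: its entry at spot `j` is the car
that parks in spot `j`. -/
noncomputable def outcome (α : Fin n → Fin n) (h : IsParkingFunction α) : Equiv.Perm (Fin n) :=
  (Equiv.ofBijective h.choose
    (Finite.injective_iff_bijective.mp h.choose_spec.injective)).symm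

/-! ### Fubini rankings -/

/-- `α` records a valid ranking of `n` competitors with ties allowed: the rank of a competitor
is one more than the number of competitors ranked strictly better (with the shift by one, it is
that number).  So if `m` competitors tie at rank `r`, the next available rank is `r + m`. -/
def IsFubiniRanking (α : Fin n → Fin n) : Prop :=
  ∀ i, (α i : ℕ) = (Finset.univ.filter fun j => α j < α i).card

/-- The number of distinct ranks. -/
def numRanks (α : Fin n → Fin n) : ℕ := (Finset.univ.image α).card

/-- The set of repeated values of `α`, as a subset of `[n - 1]`.  (In a Fubini ranking, the
value `n` cannot be repeated.) -/
def repeated (α : Fin n → Fin n) : Finset (Fin (n - 1)) :=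
  Finset.univ.filter fun i => ∃ j₁ j₂, j₁ ≠ j₂ ∧ α j₁ = lo i ∧ α j₂ = lo i

/-- In a Fubini ranking, a value just above a repeated value does not occur. -/
theorem IsFubiniRanking.ne_hi {α : Fin n → Fin n} (h : IsFubiniRanking α) {i : Fin (n - 1)}
    (hi' : i ∈ repeated α) (j : Fin n) : α j ≠ hi i := by
  intro hj
  obtain ⟨j₁, j₂, hne, h₁, h₂⟩ : ∃ j₁ j₂, j₁ ≠ j₂ ∧ α j₁ = lo i ∧ α j₂ = lo i := by
    simpa [repeated] using hi'
  have e₁ := h j₁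
  have e := h j
  rw [h₁] at e₁
  rw [hj] at e
  have hlt : lo i < hi i := by simp [lo, hi]
  have hsub : insert j₁ (insert j₂ (Finset.univ.filter fun j => α j < lo i)) ⊆
      Finset.univ.filter fun j => α j < hi i := by
    intro x hx
    simp only [Finset.mem_insert, Finset.mem_filter, Finset.mem_univ, true_and] at hx ⊢
    rcases hx with rfl | rfl | hx
    · rwa [h₁]
    · rwa [h₂]
    · exact hx.trans hlt
  have hc := Finset.card_le_card hsub
  rw [Finset.card_insert_of_notMem (by simp [hne, h₁]),
    Finset.card_insert_of_notMem (by simp [h₂]), ← e₁, ← e] at hc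
  simp [lo, hi] at hc

theorem simple_commute {i j : Fin (n - 1)} (h₁ : (i : ℕ) ≠ j + 1) (h₂ : (j : ℕ) ≠ i + 1) :
    Commute (simple i) (simple j) := by
  by_cases hij : i = j
  · rw [hij]
  · have hij' : (i : ℕ) ≠ j := fun h => hij (Fin.ext h)
    apply Equiv.Perm.Disjoint.commute
    intro x
    by_cases hx : x = lo i ∨ x = hi i
    · right
      apply Equiv.swap_apply_of_ne_of_ne <;>
        rcases hx with rfl | rfl <;> simp [lo, hi, Fin.ext_iff] <;> omega
    · left
      push Not at hx
      exact Equiv.swap_apply_of_ne_of_ne hx.1 hx.2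

/-- The transpositions `s_i`, for `i` a repeated value of a Fubini ranking, commute. -/
theorem IsFubiniRanking.commute {α : Fin n → Fin n} (h : IsFubiniRanking α) :
    (repeated α : Set (Fin (n - 1))).Pairwise (Function.onFun Commute simple) := by
  have key : ∀ i ∈ repeated α, ∀ j ∈ repeated α, (j : ℕ) ≠ i + 1 := by
    intro i hi' j hj hji
    obtain ⟨j₁, -, -, h₁, -⟩ : ∃ j₁ j₂, j₁ ≠ j₂ ∧ α j₁ = lo j ∧ α j₂ = lo j := by
      simpa [repeated] using hj
    exact h.ne_hi hi' j₁ (h₁.trans (Fin.ext (by simpa [lo, hi] using hji)))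
  intro i hi' j hj _
  exact simple_commute (key j hj i hi') (key i hi' j hj)

/-- Unit Fubini rankings of length `n`: the Fubini rankings that are unit interval parking
functions. -/
def UFR (n : ℕ) : Type :=
  {α : Fin n → Fin n // IsFubiniRanking α ∧ IsUnitIntervalParkingFunction α}

/-- The parking outcome `π` of a unit Fubini ranking. -/
noncomputable def UFR.outcome (α : UFR n) : Equiv.Perm (Fin n) :=
  UnitFubini.outcome α.1 α.2.2.isParkingFunction

/-- The product of the commuting transpositions `s_i` over the repeated values `i`. -/
def UFR.prodSimple (α : UFR n) : Equiv.Perm (Fin n) :=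
  (repeated α.1).noncommProd simple α.2.1.commute

/-- The interval `[π, π ∏_{i ∈ I} s_i]` of the right weak order, where `π` is the outcome of `α`
and `I` is its set of repeated values. -/
noncomputable def UFR.interval (α : UFR n) : Set (WeakOrder n) :=
  Set.Icc (toWeak α.outcome) (toWeak (α.outcome * α.prodSimple))

end UnitFubini

/-!
The right weak order is inclusion of inversion sets.  If `I` is a set of ascents of `π`, no two of
them consecutive, then multiplying `π` by the `s_i`, `i ∈ I`, adds one inversion for each `i`
independently of the others, so `[π, π ∏_{i ∈ I} s_i]` is Boolean.  Conversely, in a Boolean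
interval with bottom `π` the atoms are `π s_i` for certain ascents `i`, and climbing a chain shows
that an element has one more inversion than `π` for each atom below it, namely that of the atom.
By transitivity of inversions the ascents cannot be consecutive, so the interval is of the above
form.  Finally, unit Fubini rankings amount to such pairs `(π, I)`: exactly the second car of each
tied pair misses its preferred spot, so the ranks are recovered from the spots by lowering `i + 1`
to `i` for every `i ∈ I`.
-/

namespace UnitFubini

open Equiv (Perm)

variable {n : ℕ}

/-! ### Inversions and the weak order -/

theorem lo_lt_hi (i : Fin (n - 1)) : lo i < hi i := Nat.lt_succ_self _

theorem lo_injective : Function.Injective (lo (n := n)) :=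
  fun _ _ h => Fin.ext (Fin.mk.inj h)

theorem hi_injective : Function.Injective (hi (n := n)) :=
  fun _ _ h => Fin.ext (Nat.succ_injective (Fin.mk.inj h))

theorem lo_eq_hi_iff {i j : Fin (n - 1)} : lo i = hi j ↔ (i : ℕ) = j + 1 := Fin.ext_iff

theorem strictMono_of_lo_lt_hi {β : Type*} [Preorder β] {f : Fin n → β}
    (h : ∀ i, f (lo i) < f (hi i)) : StrictMono f := by
  cases n with
  | zero => exact Subsingleton.strictMono f
  | succ m => exact Fin.strictMono_iff_lt_succ.2 h

theorem simple_lt_simple_iff {i : Fin (n - 1)} {x y : Fin n} (h : ¬(x = lo i ∧ y = hi i))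
    (h' : ¬(x = hi i ∧ y = lo i)) : simple i x < simple i y ↔ x < y := by
  simp only [simple, Equiv.swap_apply_def, lo, hi, Fin.ext_iff] at h h' ⊢
  split_ifs <;> simp only [Fin.lt_def] <;> omega

theorem weakCover_iff {τ σ : Perm (Fin n)} :
    WeakCover τ σ ↔ ∃ i, τ (lo i) < τ (hi i) ∧ σ = τ * simple i := by
  refine exists_congr fun i => ⟨?_, ?_⟩
  · rintro ⟨hd, rfl⟩
    exact ⟨by simpa [IsDescent, simple] using hd, rfl⟩
  · rintro ⟨ha, rfl⟩
    exact ⟨by simpa [IsDescent, simple] using ha, rfl⟩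

theorem weakCover_of_covBy {τ σ : Perm (Fin n)} (h : toWeak τ ⋖ toWeak σ) : WeakCover τ σ := by
  have hle : Relation.ReflTransGen WeakCover τ σ := h.le
  obtain rfl | ⟨ρ, hτρ, hρσ⟩ := hle.cases_head
  · exact absurd rfl h.ne
  · have hne : ρ ≠ τ := by
      rintro rfl
      exact hτρ.toLex_lt.ne rfl
    have hσ : ρ = σ :=
      (h.eq_or_eq (c := toWeak ρ) (Relation.ReflTransGen.single hτρ) hρσ).resolve_left hne
    exact hσ ▸ hτρ

/-- The inversion set of a permutation.  An inversion is recorded by its two values `a < b`, not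
by their positions: this is the convention for which the right weak order is inclusion. -/
def inversions (σ : Perm (Fin n)) : Finset (Fin n × Fin n) :=
  Finset.univ.filter fun p => p.1 < p.2 ∧ σ.symm p.2 < σ.symm p.1

theorem mem_inversions {σ : Perm (Fin n)} {a b : Fin n} :
    (a, b) ∈ inversions σ ↔ a < b ∧ σ.symm b < σ.symm a := by
  simp [inversions]

theorem inversions_trans {σ : Perm (Fin n)} {a b c : Fin n} (hab : (a, b) ∈ inversions σ)
    (hbc : (b, c) ∈ inversions σ) : (a, c) ∈ inversions σ := by
  rw [mem_inversions] at *
  exact ⟨hab.1.trans hbc.1, hbc.2.trans hab.2⟩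

/-- The pair of values of `σ` at the positions `i` and `i + 1`, which becomes an inversion when
`σ` goes up to `σ s_i`. -/
def adjacentPair (σ : Perm (Fin n)) (i : Fin (n - 1)) : Fin n × Fin n := (σ (lo i), σ (hi i))

theorem adjacentPair_injective (σ : Perm (Fin n)) : Function.Injective (adjacentPair σ) :=
  fun _ _ h => lo_injective (σ.injective (Prod.ext_iff.1 h).1)

theorem adjacentPair_notMem_inversions (σ : Perm (Fin n)) (i : Fin (n - 1)) :
    adjacentPair σ i ∉ inversions σ := by
  simpa [adjacentPair, mem_inversions] using fun _ => (lo_lt_hi i).le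

theorem inversions_mul_simple {σ : Perm (Fin n)} {i : Fin (n - 1)} (h : σ (lo i) < σ (hi i)) :
    inversions (σ * simple i) = insert (adjacentPair σ i) (inversions σ) := by
  ext ⟨a, b⟩
  obtain ⟨x, rfl⟩ := σ.surjective a
  obtain ⟨y, rfl⟩ := σ.surjective b
  have symm_apply (z : Fin n) : (σ * simple i).symm (σ z) = simple i z := by
    simp [Equiv.symm_apply_eq, simple]
  simp only [Finset.mem_insert, mem_inversions, symm_apply, Equiv.symm_apply_apply, adjacentPair,
    Prod.mk.injEq, σ.injective.eq_iff]
  by_cases hxy : x = lo i ∧ y = hi i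
  · obtain ⟨rfl, rfl⟩ := hxy
    simp [h, simple, lo_lt_hi]
  by_cases hyx : x = hi i ∧ y = lo i
  · obtain ⟨rfl, rfl⟩ := hyx
    simp [h.not_gt, (lo_lt_hi i).ne]
  · rw [simple_lt_simple_iff (by tauto) (by tauto)]
    tauto

theorem WeakCover.inversions_subset {τ σ : Perm (Fin n)} (h : WeakCover τ σ) :
    inversions τ ⊆ inversions σ := by
  obtain ⟨i, hasc, rfl⟩ := weakCover_iff.1 h
  exact inversions_mul_simple hasc ▸ Finset.subset_insert _ _

theorem exists_adjacentPair_mem_inversions {σ τ : Perm (Fin n)}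
    (h : inversions σ ⊆ inversions τ) (hne : σ ≠ τ) :
    ∃ i, σ (lo i) < σ (hi i) ∧ adjacentPair σ i ∈ inversions τ := by
  by_contra! hno
  have hmono : StrictMono (τ⁻¹ * σ) := strictMono_of_lo_lt_hi fun i => by
    change τ.symm (σ (lo i)) < τ.symm (σ (hi i))
    rcases lt_or_gt_of_ne (σ.injective.ne (lo_lt_hi i).ne) with hasc | hdesc
    · have hnot : ¬τ.symm (σ (hi i)) < τ.symm (σ (lo i)) := fun hinv =>
        hno i hasc (mem_inversions.2 ⟨hasc, hinv⟩)
      exact (not_lt.1 hnot).lt_of_ne ((τ.symm.injective.comp σ.injective).ne (lo_lt_hi i).ne)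
    · exact (mem_inversions.1 (h (mem_inversions.2 ⟨hdesc, by simpa using lo_lt_hi i⟩))).2
  exact hne (inv_mul_eq_one.1 (DFunLike.coe_injective hmono.eq_id)).symm

theorem le_of_inversions_subset {σ τ : Perm (Fin n)} (h : inversions σ ⊆ inversions τ) :
    toWeak σ ≤ toWeak τ := by
  induction hs : inversions σ using WellFoundedGT.induction generalizing σ with
  | ind s ih =>
    subst hs
    by_cases hne : σ = τ
    · exact hne ▸ le_rfl
    obtain ⟨i, hasc, hmem⟩ := exists_adjacentPair_mem_inversions h hne
    have hinv := inversions_mul_simple hasc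
    have hlt : inversions σ < inversions (σ * simple i) :=
      hinv ▸ Finset.ssubset_insert (adjacentPair_notMem_inversions σ i)
    have hle : toWeak (σ * simple i) ≤ toWeak τ :=
      ih _ hlt (hinv ▸ Finset.insert_subset hmem h) rfl
    exact Relation.ReflTransGen.head (weakCover_iff.2 ⟨i, hasc, rfl⟩) hle

theorem toWeak_le_toWeak_iff {σ τ : Perm (Fin n)} :
    toWeak σ ≤ toWeak τ ↔ inversions σ ⊆ inversions τ := by
  refine ⟨fun h => ?_, le_of_inversions_subset⟩
  change Relation.ReflTransGen WeakCover σ τ at h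
  induction h with
  | refl => exact subset_rfl
  | tail _ hc ih => exact ih.trans hc.inversions_subset

theorem inversions_injective : Function.Injective (inversions (n := n)) := fun _ _ h =>
  le_antisymm (α := WeakOrder n) (toWeak_le_toWeak_iff.2 h.subset)
    (toWeak_le_toWeak_iff.2 h.symm.subset)

/-! ### Boolean intervals -/

/-- No two elements of `J` are consecutive, so that the `s_i`, `i ∈ J`, have disjoint supports. -/
def IsSparse (J : Finset (Fin (n - 1))) : Prop := ∀ i ∈ J, ∀ j ∈ J, (j : ℕ) ≠ i + 1

theorem IsSparse.mono {J K : Finset (Fin (n - 1))} (hK : IsSparse K) (hJK : J ⊆ K) : IsSparse J :=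
  fun i hi' j hj => hK i (hJK hi') j (hJK hj)

theorem IsSparse.lo_ne_hi {J : Finset (Fin (n - 1))} (hJ : IsSparse J) {i j : Fin (n - 1)}
    (hi' : i ∈ J) (hj : j ∈ J) : lo i ≠ hi j :=
  fun e => hJ j hj i hi' (lo_eq_hi_iff.1 e)

theorem IsSparse.commute {J : Finset (Fin (n - 1))} (hJ : IsSparse J) :
    (J : Set (Fin (n - 1))).Pairwise (Function.onFun Commute simple) :=
  fun i hi' j hj _ => simple_commute (hJ j hj i hi') (hJ i hi' j hj)

/-- `J` is a set of ascents of `π`, no two of which are consecutive. -/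
structure SparseAscents (π : Perm (Fin n)) (J : Finset (Fin (n - 1))) : Prop where
  isSparse : IsSparse J
  apply_lo_lt_apply_hi : ∀ i ∈ J, π (lo i) < π (hi i)

namespace SparseAscents

variable {π : Perm (Fin n)} {J K : Finset (Fin (n - 1))} {i : Fin (n - 1)}

theorem mono (hK : SparseAscents π K) (hJK : J ⊆ K) : SparseAscents π J :=
  ⟨hK.isSparse.mono hJK, fun i hi' => hK.apply_lo_lt_apply_hi i (hJK hi')⟩

/-- The permutation `π ∏_{i ∈ J} s_i`, in which the ascents `i ∈ J` of `π` have been turned into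
descents. -/
def flip (hJ : SparseAscents π J) : Perm (Fin n) := π * J.noncommProd simple hJ.isSparse.commute

theorem flip_empty (h : SparseAscents π ∅) : h.flip = π := by
  simp [flip]

theorem flip_insert (h : SparseAscents π (insert i J)) (hi' : i ∉ J) :
    h.flip = (h.mono (Finset.subset_insert i J)).flip * simple i := by
  simp only [flip, Finset.noncommProd_insert_of_notMem' _ _ _ _ hi', mul_assoc]

theorem flip_apply_of_ne (hJ : SparseAscents π J) {x : Fin n}
    (hx : ∀ j ∈ J, x ≠ lo j ∧ x ≠ hi j) : hJ.flip x = π x := by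
  induction J using Finset.induction_on with
  | empty => rw [flip_empty]
  | insert j J hj ih =>
    rw [Finset.forall_mem_insert] at hx
    rw [flip_insert hJ hj, Equiv.Perm.mul_apply, simple,
      Equiv.swap_apply_of_ne_of_ne hx.1.1 hx.1.2, ih _ hx.2]

theorem adjacentPair_flip (h : SparseAscents π (insert i J)) (hi' : i ∉ J) :
    adjacentPair (h.mono (Finset.subset_insert i J)).flip i = adjacentPair π i := by
  have hi_mem := Finset.mem_insert_self i J
  refine Prod.ext (flip_apply_of_ne _ fun j hj => ?_) (flip_apply_of_ne _ fun j hj => ?_) <;>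
    have hj_mem := Finset.mem_insert_of_mem (b := i) hj <;>
    have hij : i ≠ j := (ne_of_mem_of_not_mem hj hi').symm
  · exact ⟨lo_injective.ne hij, h.isSparse.lo_ne_hi hi_mem hj_mem⟩
  · exact ⟨(h.isSparse.lo_ne_hi hj_mem hi_mem).symm, hi_injective.ne hij⟩

theorem inversions_flip (hJ : SparseAscents π J) :
    inversions hJ.flip = inversions π ∪ J.image (adjacentPair π) := by
  induction J using Finset.induction_on with
  | empty => rw [flip_empty, Finset.image_empty, Finset.union_empty]
  | insert i J hi' ih =>
    have hpair := adjacentPair_flip hJ hi'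
    have hasc : (adjacentPair π i).1 < (adjacentPair π i).2 :=
      hJ.apply_lo_lt_apply_hi i (Finset.mem_insert_self i J)
    rw [← hpair] at hasc
    rw [flip_insert hJ hi', inversions_mul_simple hasc, hpair, ih, Finset.image_insert,
      Finset.union_insert]

theorem adjacentPair_mem_inversions_flip_iff (hJ : SparseAscents π J) :
    adjacentPair π i ∈ inversions hJ.flip ↔ i ∈ J := by
  simp [inversions_flip, adjacentPair_notMem_inversions, (adjacentPair_injective π).eq_iff]

theorem flip_le_flip_iff (hJ : SparseAscents π J) (hK : SparseAscents π K) :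
    toWeak hJ.flip ≤ toWeak hK.flip ↔ J ⊆ K := by
  rw [toWeak_le_toWeak_iff]
  refine ⟨fun h i hi' => ?_, fun h => ?_⟩
  · exact hK.adjacentPair_mem_inversions_flip_iff.1
      (h (hJ.adjacentPair_mem_inversions_flip_iff.2 hi'))
  · rw [inversions_flip, inversions_flip]
    exact Finset.union_subset_union_right (Finset.image_subset_image h)

theorem le_flip (hJ : SparseAscents π J) : toWeak π ≤ toWeak hJ.flip := by
  rw [toWeak_le_toWeak_iff, inversions_flip]
  exact Finset.subset_union_left

theorem mem_Icc_flip_iff (hJ : SparseAscents π J) {ρ : Perm (Fin n)} :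
    toWeak ρ ∈ Set.Icc (toWeak π) (toWeak hJ.flip) ↔
      ∃ (K : Finset (Fin (n - 1))) (hKJ : K ⊆ J), ρ = (hJ.mono hKJ).flip := by
  refine ⟨fun ⟨hπρ, hρ⟩ => ?_, ?_⟩
  · rw [toWeak_le_toWeak_iff] at hπρ hρ
    refine ⟨J.filter (adjacentPair π · ∈ inversions ρ), Finset.filter_subset _ _,
      inversions_injective ?_⟩
    rw [inversions_flip] at hρ ⊢
    rw [← Finset.filter_image (p := (· ∈ inversions ρ)), Finset.filter_mem_eq_inter,
      Finset.union_inter_distrib_left, Finset.union_eq_right.2 hπρ, Finset.inter_eq_right.2 hρ]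
  · rintro ⟨K, hKJ, rfl⟩
    exact ⟨le_flip _, (flip_le_flip_iff _ hJ).2 hKJ⟩

/-- The parametrization of the interval `[π, π ∏_{a} s_{c a}]` by the subsets of the index type of
the family `c` of ascents. -/
noncomputable def intervalIso {ι : Type*} [Fintype ι] {c : ι ↪ Fin (n - 1)}
    (h : SparseAscents π (Finset.univ.map c)) :
    Finset ι ≃o Set.Icc (toWeak π) (toWeak h.flip) :=
  have hsub (S : Finset ι) : S.map c ⊆ Finset.univ.map c := Finset.map_subset_map.2 S.subset_univ
  OrderIso.ofSurjective
    (OrderEmbedding.ofMapLEIff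
      (fun S => ⟨toWeak (h.mono (hsub S)).flip, h.mem_Icc_flip_iff.2 ⟨_, hsub S, rfl⟩⟩)
      fun _ _ => (flip_le_flip_iff (h.mono (hsub _)) (h.mono (hsub _))).trans Finset.map_subset_map)
    fun ⟨ρ, hρ⟩ => by
      obtain ⟨K, hK, rfl⟩ := h.mem_Icc_flip_iff.1 hρ
      obtain ⟨S, -, rfl⟩ := Finset.subset_map_iff.1 hK
      exact ⟨S, rfl⟩

theorem isBooleanInterval (hJ : SparseAscents π J) :
    IsBooleanInterval J.card (Set.Icc (toWeak π) (toWeak hJ.flip)) := by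
  obtain ⟨k, hk⟩ : ∃ k, J.card = k := ⟨_, rfl⟩
  obtain ⟨c, rfl⟩ : ∃ c : Fin k ↪ Fin (n - 1), J = Finset.univ.map c :=
    ⟨(J.orderEmbOfFin hk).toEmbedding, (J.map_orderEmbOfFin_univ hk).symm⟩
  rw [hk]
  exact ⟨⟨_, _, hJ.le_flip, rfl⟩, ⟨hJ.intervalIso.symm⟩⟩

end SparseAscents

/-- `g` embeds the Boolean lattice of finite subsets of `ι` in the weak order, taking covers to
covers.  The isomorphisms from a Boolean lattice to an interval are of this kind. -/
structure IsBooleanEmbedding {ι : Type*} [DecidableEq ι] (g : Finset ι → Perm (Fin n)) : Prop where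
  le_iff : ∀ {S T}, toWeak (g S) ≤ toWeak (g T) ↔ S ⊆ T
  weakCover_insert : ∀ {S a}, a ∉ S → WeakCover (g S) (g (insert a S))

namespace IsBooleanEmbedding

variable {ι : Type*} [DecidableEq ι] {g : Finset ι → Perm (Fin n)}

theorem inversions_subset_iff (hg : IsBooleanEmbedding g) {S T : Finset ι} :
    inversions (g S) ⊆ inversions (g T) ↔ S ⊆ T :=
  toWeak_le_toWeak_iff.symm.trans hg.le_iff

theorem exists_atom (hg : IsBooleanEmbedding g) (a : ι) :
    ∃ i, g ∅ (lo i) < g ∅ (hi i) ∧ g {a} = g ∅ * simple i := by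
  simpa only [insert_empty_eq] using weakCover_iff.1 (hg.weakCover_insert (Finset.notMem_empty a))

/-- The position `i` for which the atom `{a}` is sent to `π s_i`, where `π` is the image of `∅`. -/
noncomputable def atom (hg : IsBooleanEmbedding g) (a : ι) : Fin (n - 1) :=
  (hg.exists_atom a).choose

theorem lo_atom_lt_hi_atom (hg : IsBooleanEmbedding g) (a : ι) :
    g ∅ (lo (hg.atom a)) < g ∅ (hi (hg.atom a)) :=
  (hg.exists_atom a).choose_spec.1

theorem inversions_singleton (hg : IsBooleanEmbedding g) (a : ι) :
    inversions (g {a}) = insert (adjacentPair (g ∅) (hg.atom a)) (inversions (g ∅)) := by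
  rw [(hg.exists_atom a).choose_spec.2]
  exact inversions_mul_simple (hg.lo_atom_lt_hi_atom a)

theorem adjacentPair_atom_mem_inversions_iff (hg : IsBooleanEmbedding g) {a : ι} {S : Finset ι} :
    adjacentPair (g ∅) (hg.atom a) ∈ inversions (g S) ↔ a ∈ S := by
  rw [← Finset.singleton_subset_iff (a := a) (s := S), ← hg.inversions_subset_iff,
    inversions_singleton, Finset.insert_subset_iff,
    and_iff_left (hg.inversions_subset_iff.2 (Finset.empty_subset S))]

theorem atom_injective (hg : IsBooleanEmbedding g) : Function.Injective hg.atom := fun a b h => by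
  have ha := hg.adjacentPair_atom_mem_inversions_iff.2 (Finset.mem_singleton_self a)
  rw [h, adjacentPair_atom_mem_inversions_iff] at ha
  exact (Finset.mem_singleton.1 ha).symm

theorem inversions_eq (hg : IsBooleanEmbedding g) (S : Finset ι) :
    inversions (g S) = inversions (g ∅) ∪ S.image (adjacentPair (g ∅) ∘ hg.atom) := by
  induction S using Finset.induction_on with
  | empty => rw [Finset.image_empty, Finset.union_empty]
  | insert a S ha ih =>
    obtain ⟨i, hasc, heq⟩ := weakCover_iff.1 (hg.weakCover_insert ha)
    have hinv := inversions_mul_simple hasc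
    rw [← heq] at hinv
    have hmem := hg.adjacentPair_atom_mem_inversions_iff.2 (Finset.mem_insert_self a S)
    rw [hinv, Finset.mem_insert, or_iff_left (mt hg.adjacentPair_atom_mem_inversions_iff.1 ha)]
      at hmem
    rw [hinv, ih, ← hmem, Finset.image_insert, Finset.union_insert, Function.comp_apply]

theorem atom_ne_atom_add_one (hg : IsBooleanEmbedding g) (a b : ι) :
    (hg.atom b : ℕ) ≠ hg.atom a + 1 := by
  intro hab
  have hlo : lo (hg.atom b) = hi (hg.atom a) := lo_eq_hi_iff.2 hab
  have ha := hg.adjacentPair_atom_mem_inversions_iff.2 (Finset.mem_insert_self a {b})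
  have hb := hg.adjacentPair_atom_mem_inversions_iff.2
    (Finset.mem_insert_of_mem (b := a) (Finset.mem_singleton_self b))
  rw [adjacentPair] at ha
  rw [adjacentPair, hlo] at hb
  -- By transitivity, the join of the two atoms inverts a third pair, which belongs to no atom.
  have hac := inversions_trans ha hb
  have hlt : lo (hg.atom a) < hi (hg.atom b) :=
    (lo_lt_hi _).trans (hlo ▸ lo_lt_hi (hg.atom b))
  rw [hg.inversions_eq, Finset.mem_union, mem_inversions, Equiv.symm_apply_apply,
    Equiv.symm_apply_apply, Finset.mem_image] at hac
  obtain ⟨-, hgt⟩ | ⟨c, -, heq⟩ := hac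
  · exact hlt.not_gt hgt
  · have hatom_ne : hg.atom a ≠ hg.atom b := fun h => by omega
    obtain ⟨hlo_c, hhi_c⟩ := Prod.ext_iff.1 heq
    have hca : hg.atom c = hg.atom a := lo_injective ((g ∅).injective hlo_c)
    have hcb : hg.atom c = hg.atom b := hi_injective ((g ∅).injective hhi_c)
    exact hatom_ne (hca.symm.trans hcb)

theorem sparseAscents (hg : IsBooleanEmbedding g) (S : Finset ι) :
    SparseAscents (g ∅) (S.image hg.atom) where
  isSparse := by
    simp only [IsSparse, Finset.forall_mem_image]
    exact fun a _ b _ => hg.atom_ne_atom_add_one a b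
  apply_lo_lt_apply_hi := Finset.forall_mem_image.2 fun a _ => hg.lo_atom_lt_hi_atom a

theorem eq_flip (hg : IsBooleanEmbedding g) (S : Finset ι) : g S = (hg.sparseAscents S).flip :=
  inversions_injective <| by
    rw [hg.inversions_eq, SparseAscents.inversions_flip, Finset.image_image]

end IsBooleanEmbedding

theorem isBooleanEmbedding_of_orderIso_Icc {ι : Type*} [DecidableEq ι] {σ τ : WeakOrder n}
    (e : Finset ι ≃o Set.Icc σ τ) : IsBooleanEmbedding fun S => (e S : WeakOrder n) where
  le_iff := e.le_iff_le
  weakCover_insert ha := by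
    have hcovBy := (apply_covBy_apply_iff e).2 (Finset.covBy_insert ha)
    have hconn : (Set.range (OrderEmbedding.subtype (· ∈ Set.Icc σ τ))).OrdConnected :=
      Subtype.range_coe.symm ▸ Set.ordConnected_Icc
    exact weakCover_of_covBy ((hconn.apply_covBy_apply_iff _).2 hcovBy)

theorem IsBooleanInterval.exists_sparseAscents {k : ℕ} {B : Set (WeakOrder n)}
    (hB : IsBooleanInterval k B) :
    ∃ (π : Perm (Fin n)) (J : Finset (Fin (n - 1))) (h : SparseAscents π J),
      J.card = k ∧ B = Set.Icc (toWeak π) (toWeak h.flip) := by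
  obtain ⟨⟨σ, τ, hστ, rfl⟩, ⟨e⟩⟩ := hB
  have hg := isBooleanEmbedding_of_orderIso_Icc e.symm
  refine ⟨_, _, hg.sparseAscents Finset.univ, ?_, ?_⟩
  · rw [Finset.card_image_of_injective _ hg.atom_injective, Finset.card_univ, Fintype.card_fin]
  · rw [← hg.eq_flip]
    have hbot : e.symm ∅ = ⟨σ, Set.left_mem_Icc.2 hστ⟩ :=
      le_antisymm (e.symm_apply_le.2 (Finset.empty_subset _)) (e.symm ∅).2.1
    have htop : e.symm Finset.univ = ⟨τ, Set.right_mem_Icc.2 hστ⟩ :=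
      le_antisymm (e.symm Finset.univ).2.2 (e.le_symm_apply.2 (Finset.subset_univ _))
    simp only [hbot, htop]
    rfl

/-! ### Unit Fubini rankings -/

section Parking

variable {α s : Fin n → Fin n} {i : Fin (n - 1)}

theorem Parks.outcome_symm (hs : Parks α s) (h : IsParkingFunction α) :
    ⇑(outcome α h).symm = s :=
  h.choose_spec.unique hs

theorem mem_repeated :
    i ∈ repeated α ↔ ∃ j₁ j₂, j₁ ≠ j₂ ∧ α j₁ = lo i ∧ α j₂ = lo i := by
  simp [repeated]

theorem IsFubiniRanking.isSparse_repeated (h : IsFubiniRanking α) : IsSparse (repeated α) := by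
  intro i hi' j hj hji
  obtain ⟨c, -, -, hc, -⟩ := mem_repeated.1 hj
  exact h.ne_hi hi' c (hc.trans (lo_eq_hi_iff.2 hji))

theorem Parks.exists_lt_of_mem_repeated (hs : Parks α s)
    (hu : ∀ c, (s c : ℕ) = α c ∨ (s c : ℕ) = α c + 1) (hi' : i ∈ repeated α) :
    ∃ c d, c < d ∧ s c = lo i ∧ s d = hi i := by
  obtain ⟨c, d, hcd, hc, hd⟩ : ∃ c d, c < d ∧ α c = lo i ∧ α d = lo i := by
    obtain ⟨c, d, hne, hc, hd⟩ := mem_repeated.1 hi'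
    rcases hne.lt_or_gt with h | h
    · exact ⟨c, d, h, hc, hd⟩
    · exact ⟨d, c, h, hd, hc⟩
  have hne : s c ≠ s d := (hs d).1.2 c hcd
  have hle : s c ≤ s d :=
    (hs c).2 ⟨hc.trans hd.symm ▸ (hs d).1.1, fun j hj => (hs d).1.2 j (hj.trans hcd)⟩
  have huc := hu c
  have hud := hu d
  refine ⟨c, d, hcd, ?_, ?_⟩ <;>
    simp only [hc, hd, lo, hi, Fin.le_def, ne_eq, Fin.ext_iff] at hle hne huc hud ⊢ <;> omega

theorem card_filter_lt_of_injective (hs : Function.Injective s) (r : Fin n) :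
    (Finset.univ.filter fun c => s c < r).card = r := by
  rw [← Fin.card_Iio r]
  exact Finset.card_bijective s (Finite.injective_iff_bijective.1 hs) (by simp)

theorem IsFubiniRanking.exists_repeated (h : IsFubiniRanking α) (hs : Parks α s)
    (hu : ∀ c, (s c : ℕ) = α c ∨ (s c : ℕ) = α c + 1) {c : Fin n} (hc : s c ≠ α c) :
    ∃ i ∈ repeated α, α c = lo i ∧ s c = hi i := by
  have hsc : (s c : ℕ) = α c + 1 := (hu c).resolve_left (Fin.val_ne_of_ne hc)
  obtain ⟨d, hdc, hd⟩ : ∃ d < c, s d = α c := by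
    by_contra! hfree
    exact hc (le_antisymm ((hs c).2 ⟨le_rfl, hfree⟩) (hs c).1.1)
  -- If `d` preferred another spot, the cars in spots up to `α c` would be too many competitors
  -- ranked better than `c`.
  have hαd : α d = α c := by
    by_contra hne
    have hlt : α d < α c := lt_of_le_of_ne (hd ▸ (hs d).1.1) hne
    have hsub : insert d (Finset.univ.filter fun j => s j < α c) ⊆
        Finset.univ.filter fun j => α j < α c := by
      simp only [Finset.insert_subset_iff, Finset.mem_filter, Finset.mem_univ, true_and]
      exact ⟨hlt, Finset.monotone_filter_right _ fun j _ hj => (hs j).1.1.trans_lt hj⟩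
    have hcard := Finset.card_le_card hsub
    rw [Finset.card_insert_of_notMem (by simp [hd]), card_filter_lt_of_injective hs.injective,
      ← h c] at hcard
    exact Nat.not_succ_le_self _ hcard
  have hlt : (α c : ℕ) < n - 1 := by omega
  exact ⟨⟨α c, hlt⟩, mem_repeated.2 ⟨d, c, hdc.ne, hαd, rfl⟩, rfl, Fin.ext hsc⟩

end Parking

/-- The rank of the car in spot `x`, if `I` is the set of repeated ranks: the cars in the spots `i`
and `i + 1` tie at rank `i` for all `i ∈ I`, and all other ranks are equal to the spot. -/
def spotRank (I : Finset (Fin (n - 1))) (x : Fin n) : Fin n :=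
  ⟨if x ∈ I.image hi then x - 1 else x, by split_ifs <;> omega⟩

section SpotRank

variable {I : Finset (Fin (n - 1))} {i : Fin (n - 1)} {s : Fin n → Fin n} {r x : Fin n}

theorem spotRank_hi (hi' : i ∈ I) : spotRank I (hi i) = lo i := by
  simp only [spotRank, if_pos (Finset.mem_image_of_mem hi hi')]
  rfl

theorem spotRank_of_notMem (hx : x ∉ I.image hi) : spotRank I x = x := by
  simp only [spotRank, if_neg hx]

theorem IsSparse.lo_notMem_image_hi (hI : IsSparse I) (hi' : i ∈ I) : lo i ∉ I.image hi := by
  simpa only [Finset.mem_image, not_exists, not_and] using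
    fun j hj => (hI.lo_ne_hi hi' hj).symm

theorem IsSparse.spotRank_notMem_image_hi (hI : IsSparse I) (x : Fin n) :
    spotRank I x ∉ I.image hi := by
  by_cases hx : x ∈ I.image hi
  · obtain ⟨i, hi', rfl⟩ := Finset.mem_image.1 hx
    exact spotRank_hi hi' ▸ hI.lo_notMem_image_hi hi'
  · rwa [spotRank_of_notMem hx]

theorem spotRank_lt_iff (hr : r ∉ I.image hi) : spotRank I x < r ↔ x < r := by
  by_cases hx : x ∈ I.image hi
  · obtain ⟨i, hi', rfl⟩ := Finset.mem_image.1 hx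
    have hne : r ≠ hi i := fun e => hr (e ▸ hx)
    rw [spotRank_hi hi']
    simp only [Fin.lt_def, ne_eq, Fin.ext_iff, lo, hi] at hne ⊢
    omega
  · rw [spotRank_of_notMem hx]

theorem spotRank_eq_or (I : Finset (Fin (n - 1))) (x : Fin n) :
    (x : ℕ) = spotRank I x ∨ (x : ℕ) = spotRank I x + 1 := by
  by_cases hx : x ∈ I.image hi
  · obtain ⟨i, hi', rfl⟩ := Finset.mem_image.1 hx
    exact Or.inr (by rw [spotRank_hi hi']; rfl)
  · exact Or.inl (by rw [spotRank_of_notMem hx])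

theorem IsSparse.isFubiniRanking_spotRank_comp (hI : IsSparse I) (hs : Function.Injective s) :
    IsFubiniRanking (spotRank I ∘ s) := by
  intro c
  simp only [Function.comp_apply, spotRank_lt_iff (hI.spotRank_notMem_image_hi _),
    card_filter_lt_of_injective hs]

theorem IsSparse.image_spotRank_comp (hI : IsSparse I) (hs : Function.Surjective s) :
    Finset.univ.image (spotRank I ∘ s) = (I.image hi)ᶜ := by
  ext r
  rw [Finset.mem_compl]
  refine ⟨fun hr => ?_, fun hr => ?_⟩
  · obtain ⟨c, -, rfl⟩ := Finset.mem_image.1 hr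
    exact hI.spotRank_notMem_image_hi (s c)
  · obtain ⟨c, rfl⟩ := hs r
    exact Finset.mem_image.2 ⟨c, Finset.mem_univ c, spotRank_of_notMem hr⟩

theorem IsSparse.numRanks_spotRank_comp_add_card (hI : IsSparse I) (hs : Function.Surjective s) :
    numRanks (spotRank I ∘ s) + I.card = n := by
  rw [numRanks, hI.image_spotRank_comp hs, ← Finset.card_image_of_injective I hi_injective,
    Finset.card_compl_add_card, Fintype.card_fin]

theorem IsSparse.repeated_spotRank_comp (hI : IsSparse I) (hs : Function.Bijective s) :
    repeated (spotRank I ∘ s) = I := by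
  ext i
  obtain ⟨c, hc⟩ := hs.2 (lo i)
  obtain ⟨d, hd⟩ := hs.2 (hi i)
  refine ⟨fun hi' => ?_, fun hi' => ?_⟩
  · by_contra hiI
    have hne := (hI.isFubiniRanking_spotRank_comp hs.1).ne_hi hi' d
    rw [Function.comp_apply, hd, spotRank_of_notMem] at hne
    · exact hne rfl
    · rwa [hi_injective.mem_finset_image]
  · refine mem_repeated.2 ⟨c, d, ?_, ?_, ?_⟩
    · rintro rfl
      exact (lo_lt_hi i).ne (hc.symm.trans hd)
    · rw [Function.comp_apply, hc, spotRank_of_notMem (hI.lo_notMem_image_hi hi')]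
    · rw [Function.comp_apply, hd, spotRank_hi hi']

theorem IsFubiniRanking.eq_spotRank_comp {α : Fin n → Fin n} (h : IsFubiniRanking α)
    (hs : Parks α s) (hu : ∀ c, (s c : ℕ) = α c ∨ (s c : ℕ) = α c + 1) :
    α = spotRank (repeated α) ∘ s := by
  funext c
  by_cases hc : s c = α c
  · have hnotMem : α c ∉ (repeated α).image hi := by
      simpa only [Finset.mem_image, not_exists, not_and] using
        fun i hi' => (h.ne_hi hi' c).symm
    rw [Function.comp_apply, hc, spotRank_of_notMem hnotMem]
  · obtain ⟨i, hi', hα, hsc⟩ := h.exists_repeated hs hu hc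
    rw [Function.comp_apply, hα, hsc, spotRank_hi hi']

end SpotRank

theorem SparseAscents.parks {π : Perm (Fin n)} {I : Finset (Fin (n - 1))}
    (h : SparseAscents π I) : Parks (spotRank I ∘ π.symm) π.symm := by
  intro c
  refine ⟨⟨?_, fun d hd => π.symm.injective.ne hd.ne⟩, fun t ⟨ht, hfree⟩ => ?_⟩
  · have := spotRank_eq_or I (π.symm c)
    rw [Function.comp_apply, Fin.le_def]
    omega
  by_cases hc : π.symm c ∈ I.image hi
  · obtain ⟨i, hi', hci⟩ := Finset.mem_image.1 hc
    have hearlier : π (lo i) < c := by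
      simpa only [hci, Equiv.apply_symm_apply] using h.apply_lo_lt_apply_hi i hi'
    have hne := hfree _ hearlier
    rw [Function.comp_apply, ← hci, spotRank_hi hi'] at ht
    rw [Equiv.symm_apply_apply] at hne
    rw [← hci]
    exact Nat.succ_le_of_lt (Fin.lt_def.1 (lt_of_le_of_ne ht hne))
  · rwa [Function.comp_apply, spotRank_of_notMem hc] at ht

theorem SparseAscents.exists_ufr {π : Perm (Fin n)} {I : Finset (Fin (n - 1))}
    (h : SparseAscents π I) : ∃ α : UFR n, α.outcome = π ∧ repeated α.1 = I :=
  ⟨⟨spotRank I ∘ π.symm, h.isSparse.isFubiniRanking_spotRank_comp π.symm.injective,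
      π.symm, h.parks, fun c => spotRank_eq_or I (π.symm c)⟩,
    Equiv.symm_bijective.injective (DFunLike.coe_injective (h.parks.outcome_symm _)),
    h.isSparse.repeated_spotRank_comp π.symm.bijective⟩

namespace UFR

theorem parks_and_unit (α : UFR n) : Parks α.1 α.outcome.symm ∧
    ∀ c, (α.outcome.symm c : ℕ) = α.1 c ∨ (α.outcome.symm c : ℕ) = α.1 c + 1 := by
  obtain ⟨s, hs, hu⟩ := α.2.2
  have hsymm : ⇑α.outcome.symm = s := hs.outcome_symm _
  exact hsymm ▸ ⟨hs, hu⟩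

theorem eq_spotRank_comp (α : UFR n) : α.1 = spotRank (repeated α.1) ∘ α.outcome.symm :=
  α.2.1.eq_spotRank_comp α.parks_and_unit.1 α.parks_and_unit.2

theorem sparseAscents (α : UFR n) : SparseAscents α.outcome (repeated α.1) where
  isSparse := α.2.1.isSparse_repeated
  apply_lo_lt_apply_hi i hi' := by
    obtain ⟨c, d, hcd, hc, hd⟩ :=
      α.parks_and_unit.1.exists_lt_of_mem_repeated α.parks_and_unit.2 hi'
    rwa [← hc, ← hd, Equiv.apply_symm_apply, Equiv.apply_symm_apply]

theorem interval_eq (α : UFR n) :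
    α.interval = Set.Icc (toWeak α.outcome) (toWeak α.sparseAscents.flip) := rfl

theorem numRanks_add_card (α : UFR n) : numRanks α.1 + (repeated α.1).card = n := by
  have := α.sparseAscents.isSparse.numRanks_spotRank_comp_add_card α.outcome.symm.surjective
  rwa [← α.eq_spotRank_comp] at this

theorem interval_injective : Function.Injective (interval (n := n)) := by
  intro α β h
  rw [interval_eq, interval_eq, Set.Icc_eq_Icc_iff α.sparseAscents.le_flip] at h
  have hπ : α.outcome = β.outcome := h.1
  have hflip : α.sparseAscents.flip = β.sparseAscents.flip := h.2
  have hI : repeated α.1 = repeated β.1 := by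
    ext i
    rw [← α.sparseAscents.adjacentPair_mem_inversions_flip_iff,
      ← β.sparseAscents.adjacentPair_mem_inversions_flip_iff, hflip, hπ]
  exact Subtype.ext (by rw [α.eq_spotRank_comp, β.eq_spotRank_comp, hπ, hI])

end UFR

end UnitFubini

theorem mainTheorem1 (n k : ℕ) :
    Set.BijOn (UnitFubini.UFR.interval (n := n))
      {α : UnitFubini.UFR n | UnitFubini.numRanks α.1 + k = n}
      {B : Set (UnitFubini.WeakOrder n) | UnitFubini.IsBooleanInterval k B} := by
  refine ⟨fun α hα => ?_, UnitFubini.UFR.interval_injective.injOn, fun B hB => ?_⟩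
  · have hk : (UnitFubini.repeated α.1).card = k :=
      Nat.add_left_cancel (α.numRanks_add_card.trans hα.symm)
    exact hk ▸ α.sparseAscents.isBooleanInterval
  · obtain ⟨π, I, hI, rfl, rfl⟩ := UnitFubini.IsBooleanInterval.exists_sparseAscents hB
    obtain ⟨α, rfl, rfl⟩ := hI.exists_ufr
    exact ⟨α, α.numRanks_add_card, rfl⟩
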